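/- Let $\mathcal W_2$ be the set of infinite words $s=s_1s_2s_3\dots$ over $\{0,1\}$, with the linear order $\prec$ in which, if $j\ge 1$ is the smallest index with $s_j\ne t_j$, one has $s\prec t$ if and only if either $j$ is odd and $s_j<t_j$, or $j$ is even and $s_j>t_j$. The reverse $2$-shift is the map $\Sigma_2^-:(\mathcal W_2,\prec)\to(\mathcal W_2,\prec)$, $\Sigma_2^-(s_1s_2s_3\dots)=s_2s_3\dots$. For a map $f:X\to X$ of a linearly ordered set $X$ and $n\ge 1$, a point $x\in X$ is $n$-periodic if $f^n(x)=x$ and $f^i(x)\ne x$ for $1\le i<n$; its periodic pattern is the permutation $\pi=\pi_1\pi_2\dots\pi_n$ of $\{1,\dots,n\}$ whose entries are in the same relative order as $x,f(x),\dots,f^{n-1}(x)$. Let $\mathcal P_n(f)$ be the set of periodic patterns of all $n$-periodic points of $f$, let $[\pi]$ be the set of cyclic rotations $\pi_i\pi_{i+1}\dots\pi_n\pi_1\dots\pi_{i-1}$ $(1\le i\le n)$ of $\pi$, and let $$p_n(f)=\bigl|\{[\pi]:\pi\in\mathcal P_n(f)\}\bigr|.$$ Let $C'(n,i)$ be the number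 of cyclic permutations $\tau$ of $\{1,\dots,n\}$ (permutations consisting of a single $n$-cycle) with exactly $i-1$ ascents, where an ascent is an index $1\le j\le n-1$ with $\tau(j)<\tau(j+1)$. Let $$L_k(n)=\frac1n\sum_{d\mid n}\mu(d)\,k^{n/d},$$ where $\mu$ is the Möbius function. Theorem. For every $n\ge 3$ with $n\equiv 2\pmod 4$, $$p_n(\Sigma_2^-)=C'(n,2)-C'\!\left(\tfrac n2,2\right)=L_2(n).$$ -/

import Mathlib

/-!
# Periodic patterns of signed shifts

Indices are shifted by one with respect to one-line notation on `{1, …, n}`: a permutation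
`π₁ π₂ … πₙ` is an element of `Equiv.Perm (Fin n)`, and an infinite word `s₁ s₂ …` is a function
on `ℕ`.
-/

namespace SignedShift

/-! ### Periodic patterns of a map of a linearly ordered set -/

section Patterns

variable {X : Type*} [LinearOrder X]

/-- `π` is the pattern of length `n` of `f` at `x`: the entries of `π` are in the same relative
order as `x, f x, …, f^(n-1) x`.  There is such a `π` exactly when these `n` points are distinct,
and it is then unique. -/
def IsPat (x : X) (f : X → X) (n : ℕ) (π : Equiv.Perm (Fin n)) : Prop :=
  ∀ i j : Fin n, π i < π j ↔ f^[(i : ℕ)] x < f^[(j : ℕ)] x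

/-- `x` is an `n`-periodic point of `f` (with least period `n ≥ 1`). -/
def IsNPeriodicPoint (f : X → X) (n : ℕ) (x : X) : Prop :=
  0 < n ∧ f^[n] x = x ∧ ∀ i : ℕ, 1 ≤ i → i < n → f^[i] x ≠ x

/-- The set of periodic patterns of `f` of length `n`. -/
def periodicPatterns (f : X → X) (n : ℕ) : Set (Equiv.Perm (Fin n)) :=
  {π | ∃ x : X, IsNPeriodicPoint f n x ∧ IsPat x f n π}

/-- The equivalence class `[π]` of all cyclic rotations of the one-line notation of `π`:
`π * finRotate n ^ c` is the permutation `i ↦ π (i + c)`, with `i + c` taken modulo `n`. -/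
def rotationClass {n : ℕ} (π : Equiv.Perm (Fin n)) : Set (Equiv.Perm (Fin n)) :=
  {ρ | ∃ c : ℕ, ρ = π * finRotate n ^ c}

/-- The set of equivalence classes of periodic patterns of `f` of length `n`. -/
def periodicPatternClasses (f : X → X) (n : ℕ) : Set (Set (Equiv.Perm (Fin n))) :=
  rotationClass '' periodicPatterns f n

/-- The number `p_n(f)` of equivalence classes of periodic patterns of `f` of length `n`. -/
noncomputable def numPeriodicPatternClasses (f : X → X) (n : ℕ) : ℕ :=
  (periodicPatternClasses f n).ncard

end Patterns

/-! ### Signed shifts -/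

/-- Infinite words over the alphabet `{0, …, k-1}`, to be ordered by means of the signature
`σ : Fin k → {1, -1}`. -/
def Word {k : ℕ} (_σ : Fin k → ℤˣ) : Type := ℕ → Fin k

section Words

variable {k : ℕ} {σ : Fin k → ℤˣ}

/-- The number of letters of sign `-1` among the first `j` letters of `s`. -/
def negCount (s : Word σ) (j : ℕ) : ℕ :=
  ((Finset.range j).filter fun i => σ (s i) = -1).card

/-- The strict order on words: at the first position `j` where `s` and `t` differ, `s j < t j` if
the common prefix contains an even number of letters of sign `-1`, and `t j < s j` otherwise. -/
def Word.Lt (s t : Word σ) : Prop :=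
  ∃ j : ℕ, (∀ i < j, s i = t i) ∧
    ((Even (negCount s j) ∧ s j < t j) ∨ (¬ Even (negCount s j) ∧ t j < s j))

theorem negCount_congr {s t : Word σ} {j : ℕ} (h : ∀ i < j, s i = t i) :
    negCount s j = negCount t j := by
  unfold negCount
  congr 1
  apply Finset.filter_congr
  intro i hi
  rw [h i (Finset.mem_range.1 hi)]

theorem Word.lt_irrefl (s : Word σ) : ¬ Word.Lt s s := by
  rintro ⟨j, -, ⟨-, h⟩ | ⟨-, h⟩⟩ <;> exact _root_.lt_irrefl _ h

theorem Word.lt_trans {s t u : Word σ} (h₁ : Word.Lt s t) (h₂ : Word.Lt t u) : Word.Lt s u := by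
  obtain ⟨j, e₁, h₁⟩ := h₁
  obtain ⟨l, e₂, h₂⟩ := h₂
  rcases Nat.lt_trichotomy j l with hjl | hjl | hjl
  · exact ⟨j, fun i hi => (e₁ i hi).trans (e₂ i (hi.trans hjl)), by rw [← e₂ j hjl]; exact h₁⟩
  · subst hjl
    refine ⟨j, fun i hi => (e₁ i hi).trans (e₂ i hi), ?_⟩
    rw [← negCount_congr e₁] at h₂
    rcases h₁ with ⟨p, h₁⟩ | ⟨p, h₁⟩ <;> rcases h₂ with ⟨q, h₂⟩ | ⟨q, h₂⟩
    · exact Or.inl ⟨p, h₁.trans h₂⟩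
    · exact absurd p q
    · exact absurd q p
    · exact Or.inr ⟨p, h₂.trans h₁⟩
  · refine ⟨l, fun i hi => (e₁ i (hi.trans hjl)).trans (e₂ i hi), ?_⟩
    rw [e₁ l hjl, negCount_congr fun i hi => e₁ i (hi.trans hjl)]
    exact h₂

theorem Word.lt_or_lt_of_ne {s t : Word σ} (h : s ≠ t) : Word.Lt s t ∨ Word.Lt t s := by
  classical
  have hex : ∃ j, s j ≠ t j := Function.ne_iff.1 h
  have hlt : ∀ i < Nat.find hex, s i = t i := fun i hi => not_not.1 (Nat.find_min hex hi)
  have hc := negCount_congr hlt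
  have hlt' : ∀ i < Nat.find hex, t i = s i := fun i hi => (hlt i hi).symm
  by_cases p : Even (negCount s (Nat.find hex)) <;>
    rcases lt_or_gt_of_ne (Nat.find_spec hex) with q | q
  · exact Or.inl ⟨_, hlt, Or.inl ⟨p, q⟩⟩
  · exact Or.inr ⟨_, hlt', Or.inl ⟨hc ▸ p, q⟩⟩
  · exact Or.inr ⟨_, hlt', Or.inr ⟨hc ▸ p, q⟩⟩
  · exact Or.inl ⟨_, hlt, Or.inr ⟨p, q⟩⟩

open Classical in
/-- The linear order on words determined by the signature. -/
noncomputable instance : LinearOrder (Word σ) where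
  le s t := s = t ∨ Word.Lt s t
  lt s t := Word.Lt s t
  le_refl s := Or.inl rfl
  le_trans s t u := by
    rintro (rfl | h₁) (rfl | h₂)
    · exact Or.inl rfl
    · exact Or.inr h₂
    · exact Or.inr h₁
    · exact Or.inr (Word.lt_trans h₁ h₂)
  le_antisymm s t := by
    rintro (h₁ | h₁) (h₂ | h₂)
    · exact h₁
    · exact h₁
    · exact h₂.symm
    · exact absurd (Word.lt_trans h₁ h₂) (Word.lt_irrefl s)
  lt_iff_le_not_ge s t := by
    constructor
    · intro h
      refine ⟨Or.inr h, ?_⟩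
      rintro (rfl | h')
      · exact Word.lt_irrefl _ h
      · exact Word.lt_irrefl _ (Word.lt_trans h h')
    · rintro ⟨rfl | h, h'⟩
      · exact absurd (Or.inl rfl) h'
      · exact h
  le_total s t := by
    by_cases h : s = t
    · exact Or.inl (Or.inl h)
    · exact (Word.lt_or_lt_of_ne h).imp Or.inr Or.inr
  toDecidableLE := Classical.decRel _

/-- The signed shift with signature `σ`: it deletes the first letter. -/
def signedShift (σ : Fin k → ℤˣ) : Word σ → Word σ := fun s i => s (i + 1)

end Words

/-- The reverse `k`-shift, i.e. the signed shift all of whose signs are `-1`. -/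
def reverseShift (k : ℕ) : Word (fun _ : Fin k => (-1 : ℤˣ)) → Word (fun _ : Fin k => (-1 : ℤˣ)) :=
  signedShift fun _ : Fin k => (-1 : ℤˣ)

/-! ### The enumerating quantities -/

/-- The number of ascents of a permutation: positions `i`, not the last one, with
`τ i < τ (i + 1)`. -/
def asc {n : ℕ} (τ : Equiv.Perm (Fin n)) : ℕ :=
  (Finset.univ.filter fun i : Fin n => ∃ h : (i : ℕ) + 1 < n, τ i < τ ⟨(i : ℕ) + 1, h⟩).card

/-- `C'(n, i)`: the number of cyclic permutations of `n` points (a single cycle through all of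
them) with `i - 1` ascents. -/
noncomputable def numCyclesWithAscents (n i : ℕ) : ℕ :=
  {τ : Equiv.Perm (Fin n) | τ.IsCycleOn Set.univ ∧ asc τ + 1 = i}.ncard

/-- `L_k(n) = (1/n) ∑_{d ∣ n} μ(d) k^(n/d)`. -/
def necklaceNumber (k n : ℕ) : ℚ :=
  (1 / (n : ℚ)) * ∑ d ∈ n.divisors, (ArithmeticFunction.moebius d : ℚ) * (k : ℚ) ^ (n / d)

end SignedShift

/-!
Let `f` be the reverse `2`-shift. If `x` has least period `n ≥ 3`, then `f` permutes the orbit of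
`x`, and the ranks of the points turn it into a cycle `τ` of full length. Two patterns are rotations
of each other exactly when their cycles agree (`rotationClass_eq_iff`), so `p_n(f)` is the number of
cycles realized by an orbit (`numPeriodicPatternClasses_reverseShift`). As `f` reverses the order of
two words with the same first letter, `τ` is decreasing on the points with first letter `0` and on
those with first letter `1`; the first letters form a *labeling* of `τ`. A cycle of length at least
`3` is not decreasing, so it has at most one labeling, and it has one exactly when it has one
ascent (`numCyclesWithAscents_two`). The labeling gives back the words, as itineraries. Hence the
pairs of a realized cycle and a point of it are the words of least period `n`
(`ncard_primitiveWords`), and Möbius inversion shows that the number of realized cycles is `L_2(n)`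
(`necklaceNumber_two_eq`).

A cycle of length `n` with one ascent fails to be realized exactly when two of its points have the
same itinerary. Such points are half a turn apart (`IsReverseLabeling.pow_eq_of_itinerary_eq`), and
by monotonicity of itineraries they are neighbours. Identifying them gives a cycle of length `n / 2`
with one ascent, from which the original one is recovered by doubling every point
(`exists_eq_double`). If `n / 2` is odd, every doubled cycle is again a cycle, because `n / 2` steps
along it exchange the points of a pair (`isCycleOn_double`). Therefore
`C'(n, 2) = p_n(f) + C'(n / 2, 2)` for `n ≡ 2` modulo `4` (`ncard_reverseCycles_mul_two`).
-/

namespace SignedShift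

/-! ### The order on words and the reverse shift -/

/-- Binary words with the alternating order `≺`. -/
abbrev AltWord : Type := Word (fun _ : Fin 2 => (-1 : ℤˣ))

theorem altWord_lt_iff {s t : AltWord} :
    s < t ↔ ∃ j : ℕ, (∀ i < j, s i = t i) ∧ ((Even j ∧ s j < t j) ∨ (¬ Even j ∧ t j < s j)) := by
  have h : ∀ j, negCount s j = j := fun j => by simp [negCount]
  change Word.Lt s t ↔ _
  simp only [Word.Lt, h]

theorem head_le_of_lt {s t : AltWord} (h : s < t) : s 0 ≤ t 0 := by
  obtain ⟨j, hj, h⟩ := altWord_lt_iff.1 h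
  rcases Nat.eq_zero_or_pos j with rfl | h0
  · simpa using h.imp And.right id |>.elim le_of_lt (fun h => absurd Even.zero h.1)
  · exact (hj 0 h0).le

theorem reverseShift_lt_of_lt {s t : AltWord} (h : s < t) (h0 : s 0 = t 0) :
    reverseShift 2 t < reverseShift 2 s := by
  obtain ⟨j, hj, h⟩ := altWord_lt_iff.1 h
  cases j with
  | zero => simp [h0] at h
  | succ j =>
    refine altWord_lt_iff.2 ⟨j, fun i hi => (hj (i + 1) (by omega)).symm, ?_⟩
    rw [Nat.even_add_one, not_not] at h
    exact h.symm

theorem iterate_reverseShift_apply (k : ℕ) (s : AltWord) (m : ℕ) :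
    (reverseShift 2)^[k] s m = s (m + k) := by
  induction k generalizing s with
  | zero => rfl
  | succ k ih =>
    rw [Function.iterate_succ_apply, ih]
    change s (m + k + 1) = _
    rw [add_assoc]

/-! ### Labelings and itineraries -/

/-- A monotone labeling of `Fin n` by two letters such that `τ` is decreasing on each set of
equally labeled points.  Such labelings are the places where the one-line notation of `τ` can be
cut into two decreasing runs. -/
def IsReverseLabeling {n : ℕ} (τ : Equiv.Perm (Fin n)) (c : Fin n → Fin 2) : Prop :=
  Monotone c ∧ ∀ i j, i < j → c i = c j → τ j < τ i

/-- The word of labels that are met along the `τ`-orbit of `i`. -/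
def itinerary {n : ℕ} (τ : Equiv.Perm (Fin n)) (c : Fin n → Fin 2) (i : Fin n) : AltWord :=
  fun k => c ((τ ^ k) i)

/-- `g` is a strictly increasing enumeration of words on which the reverse shift acts as `τ`. -/
def IsRealization {n : ℕ} (τ : Equiv.Perm (Fin n)) (g : Fin n → AltWord) : Prop :=
  StrictMono g ∧ ∀ i, reverseShift 2 (g i) = g (τ i)

section

variable {n : ℕ} {τ : Equiv.Perm (Fin n)} {c : Fin n → Fin 2} {g : Fin n → AltWord}

theorem iterate_reverseShift_of_semiconj (hg : ∀ i, reverseShift 2 (g i) = g (τ i)) (k : ℕ)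
    (i : Fin n) : (reverseShift 2)^[k] (g i) = g ((τ ^ k) i) := by
  induction k generalizing i with
  | zero => rfl
  | succ k ih => rw [Function.iterate_succ_apply, hg, ih, pow_succ, Equiv.Perm.mul_apply]

theorem reverseShift_itinerary (i : Fin n) :
    reverseShift 2 (itinerary τ c i) = itinerary τ c (τ i) := by
  funext k
  change c ((τ ^ (k + 1)) i) = c ((τ ^ k) (τ i))
  rw [pow_succ, Equiv.Perm.mul_apply]

/-- Two points with the same labels along `k` steps are exchanged in order at each step. -/
theorem IsReverseLabeling.pow_lt_pow (hc : IsReverseLabeling τ c) {i j : Fin n} (hij : i < j)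
    (k : ℕ) (h : ∀ l < k, c ((τ ^ l) i) = c ((τ ^ l) j)) :
    (Even k → (τ ^ k) i < (τ ^ k) j) ∧ (¬ Even k → (τ ^ k) j < (τ ^ k) i) := by
  induction k with
  | zero => simpa using hij
  | succ k ih =>
    have ih := ih fun l hl => h l (by omega)
    have hk := h k (by omega)
    rw [Nat.even_add_one, not_not, pow_succ', Equiv.Perm.mul_apply, Equiv.Perm.mul_apply]
    exact ⟨fun e => hc.2 _ _ (ih.2 e) hk.symm, fun e => hc.2 _ _ (ih.1 e) hk⟩

theorem IsReverseLabeling.monotone_itinerary (hc : IsReverseLabeling τ c) :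
    Monotone (itinerary τ c) := by
  intro i j hij
  rcases hij.eq_or_lt with rfl | hij
  · exact le_rfl
  by_contra hlt
  obtain ⟨l, hl, h⟩ := altWord_lt_iff.1 (not_le.1 hlt)
  have key := hc.pow_lt_pow hij l fun m hm => (hl m hm).symm
  rcases h with ⟨e, h⟩ | ⟨e, h⟩
  · exact absurd (hc.1 (key.1 e).le) (not_le.2 h)
  · exact absurd (hc.1 (key.2 e).le) (not_le.2 h)

theorem IsRealization.isReverseLabeling (hg : IsRealization τ g) :
    IsReverseLabeling τ fun i => g i 0 := by
  refine ⟨fun i j hij => ?_, fun i j hij h => ?_⟩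
  · rcases hij.eq_or_lt with rfl | hij
    · exact le_rfl
    · exact head_le_of_lt (hg.1 hij)
  · have := reverseShift_lt_of_lt (hg.1 hij) h
    rw [hg.2, hg.2] at this
    exact hg.1.lt_iff_lt.1 this

theorem IsRealization.eq_itinerary (hg : IsRealization τ g) :
    g = itinerary τ fun i => g i 0 := by
  funext i k
  change _ = g ((τ ^ k) i) 0
  rw [← iterate_reverseShift_of_semiconj hg.2, iterate_reverseShift_apply, zero_add]

/-! ### Uniqueness of labelings and ascents -/

theorem pow_apply_eq_iff (hτ : τ.IsCycleOn Set.univ) (i : Fin n) (k : ℕ) :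
    (τ ^ k) i = i ↔ n ∣ k := by
  have h : τ.IsCycleOn ((Finset.univ : Finset (Fin n)) : Set (Fin n)) := by simpa using hτ
  simpa using h.pow_apply_eq (Finset.mem_univ i) (n := k)

theorem exists_pow_eq (hτ : τ.IsCycleOn Set.univ) (i j : Fin n) :
    ∃ k < n, (τ ^ k) i = j := by
  have h : τ.IsCycleOn ((Finset.univ : Finset (Fin n)) : Set (Fin n)) := by simpa using hτ
  simpa using h.exists_pow_eq (Finset.mem_univ i) (Finset.mem_univ j)

/-- A decreasing permutation squares to the identity, so it is not a cycle of length `≥ 3`. -/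
theorem not_forall_lt_of_isCycleOn (hn : 3 ≤ n) (hτ : τ.IsCycleOn Set.univ) :
    ¬ ∀ i j, i < j → τ j < τ i := by
  intro h
  have hm : StrictMono (τ * τ) := fun i j hij => h _ _ (h _ _ hij)
  have h2 : ((τ * τ : Equiv.Perm (Fin n)) : Fin n → Fin n) = id :=
    hm.range_inj strictMono_id |>.1 (by simp)
  have := (pow_apply_eq_iff hτ ⟨0, by omega⟩ 2).1 (by rw [pow_two]; exact congrFun h2 _)
  have := Nat.le_of_dvd (by norm_num) this
  omega

theorem IsReverseLabeling.unique (hn : 3 ≤ n) (hτ : τ.IsCycleOn Set.univ) {c' : Fin n → Fin 2}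
    (hc : IsReverseLabeling τ c) (hc' : IsReverseLabeling τ c') : c = c' := by
  -- At a point labeled `0` by one and `1` by the other, the decreasing runs overlap.
  have key : ∀ {c c' : Fin n → Fin 2}, IsReverseLabeling τ c → IsReverseLabeling τ c' →
      ∀ i, ¬ c i < c' i := by
    intro c c' hc hc' i hi
    have h0 : ∀ p ≤ i, c p = 0 := fun p hp => by have := hc.1 hp; omega
    have h1 : ∀ p, i ≤ p → c' p = 1 := fun p hp => by have := hc'.1 hp; omega
    have hl : ∀ p q, p < q → q ≤ i → τ q < τ p := fun p q hpq hq =>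
      hc.2 p q hpq (by rw [h0 p (hpq.le.trans hq), h0 q hq])
    have hr : ∀ p q, p < q → i ≤ p → τ q < τ p := fun p q hpq hp =>
      hc'.2 p q hpq (by rw [h1 p hp, h1 q (hp.trans hpq.le)])
    refine not_forall_lt_of_isCycleOn hn hτ fun p q hpq => ?_
    rcases le_or_gt q i with hq | hq
    · exact hl p q hpq hq
    rcases le_or_gt i p with hp | hp
    · exact hr p q hpq hp
    · exact (hr i q hq le_rfl).trans (hl p i hp le_rfl)
  funext i
  exact le_antisymm (not_lt.1 (key hc' hc i)) (not_lt.1 (key hc hc' i))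

theorem IsRealization.eq_itinerary_of_isReverseLabeling (hn : 3 ≤ n) (hτ : τ.IsCycleOn Set.univ)
    (hg : IsRealization τ g) (hc : IsReverseLabeling τ c) : g = itinerary τ c := by
  rw [hg.eq_itinerary, hg.isReverseLabeling.unique hn hτ hc]

theorem IsRealization.unique (hn : 3 ≤ n) (hτ : τ.IsCycleOn Set.univ) {g' : Fin n → AltWord}
    (hg : IsRealization τ g) (hg' : IsRealization τ g') : g = g' := by
  rw [hg'.eq_itinerary]
  exact hg.eq_itinerary_of_isReverseLabeling hn hτ hg'.isReverseLabeling

theorem lt_of_consecutive_lt {i j : Fin n} (hij : i < j)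
    (h : ∀ k : ℕ, (i : ℕ) ≤ k → ∀ hk : k < (j : ℕ),
      τ ⟨k + 1, by omega⟩ < τ ⟨k, by omega⟩) : τ j < τ i := by
  have key : ∀ m : ℕ, (i : ℕ) + 1 ≤ m → ∀ hm : m ≤ (j : ℕ), τ ⟨m, by omega⟩ < τ i := by
    intro m hm
    induction m, hm using Nat.le_induction with
    | base => exact fun hm => h i le_rfl (by omega)
    | succ m hm ih => exact fun hm' => (h m (by omega) (by omega)).trans (ih (by omega))
  exact key j hij le_rfl

theorem exists_isReverseLabeling_of_asc_eq_one (h : asc τ = 1) :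
    ∃ c, IsReverseLabeling τ c := by
  obtain ⟨p, hp⟩ := Finset.card_eq_one.1 h
  have hdesc : ∀ k : ℕ, k ≠ p → ∀ hk : k + 1 < n, τ ⟨k + 1, hk⟩ < τ ⟨k, by omega⟩ := by
    intro k hkp hk
    have hmem : (⟨k, by omega⟩ : Fin n) ∉ ({p} : Finset (Fin n)) := by
      simpa [Fin.ext_iff] using hkp
    rw [← hp] at hmem
    simp only [Finset.mem_filter, Finset.mem_univ, true_and, not_exists, not_lt] at hmem
    exact lt_of_le_of_ne (hmem hk) fun e => by simpa using τ.injective e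
  refine ⟨fun i => if i ≤ p then 0 else 1, fun i j hij => ?_, fun i j hij hc => ?_⟩
  · dsimp only
    split_ifs with h1 h2
    · exact le_rfl
    · exact zero_le_one
    · exact absurd (hij.trans ‹j ≤ p›) h1
    · exact le_rfl
  · refine lt_of_consecutive_lt hij fun k hik hkj => hdesc k ?_ _
    rintro rfl
    have h1 : i ≤ p := hik
    have h2 : ¬ j ≤ p := not_le.2 hkj
    simp [h1, h2] at hc

theorem asc_eq_one_of_isReverseLabeling (hn : 3 ≤ n) (hτ : τ.IsCycleOn Set.univ)
    (hc : IsReverseLabeling τ c) : asc τ = 1 := by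
  refine le_antisymm ?_ ?_
  · -- An ascent can only occur where the label changes, which happens at most once.
    refine Finset.card_le_one.2 fun i hi j hj => ?_
    simp only [Finset.mem_filter, Finset.mem_univ, true_and] at hi hj
    have key : ∀ i : Fin n, (∃ h : (i : ℕ) + 1 < n, τ i < τ ⟨(i : ℕ) + 1, h⟩) →
        ∀ j, (i < j → c j = 1) ∧ (j ≤ i → c j = 0) := by
      rintro i ⟨h, hi⟩ j
      have hlt : i < ⟨(i : ℕ) + 1, h⟩ := Fin.lt_def.2 (Nat.lt_succ_self _)
      have hne : c i ≠ c ⟨(i : ℕ) + 1, h⟩ := fun e => absurd (hc.2 _ _ hlt e) hi.not_gt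
      have hle := hc.1 hlt.le
      refine ⟨fun hj => ?_, fun hj => ?_⟩
      · have := hc.1 (show (⟨(i : ℕ) + 1, h⟩ : Fin n) ≤ j from hj)
        omega
      · have := hc.1 hj
        omega
    by_contra hne
    rcases lt_or_gt_of_ne hne with h | h
    · have h1 := (key i hi j).1 h
      rw [(key j hj j).2 le_rfl] at h1
      exact absurd h1 (by decide)
    · have h1 := (key j hj i).1 h
      rw [(key i hi i).2 le_rfl] at h1
      exact absurd h1 (by decide)
  · rw [Nat.one_le_iff_ne_zero]
    intro h0
    have h0 := Finset.card_eq_zero.1 h0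
    refine not_forall_lt_of_isCycleOn hn hτ fun i j hij =>
      lt_of_consecutive_lt hij fun k _ hkj => ?_
    have hmem := Finset.notMem_empty (⟨k, by omega⟩ : Fin n)
    rw [← h0] at hmem
    simp only [Finset.mem_filter, Finset.mem_univ, true_and, not_exists, not_lt] at hmem
    exact lt_of_le_of_ne (hmem (by omega)) fun e => by simpa using τ.injective e

end

/-- The cycles of full length with two decreasing runs. -/
def reverseCycles (n : ℕ) : Set (Equiv.Perm (Fin n)) :=
  {τ | τ.IsCycleOn Set.univ ∧ ∃ c, IsReverseLabeling τ c}

/-- The cycles of full length that describe the action of the reverse `2`-shift on an orbit. -/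
def realizedCycles (n : ℕ) : Set (Equiv.Perm (Fin n)) :=
  {τ | τ.IsCycleOn Set.univ ∧ ∃ g, IsRealization τ g}

theorem numCyclesWithAscents_two {n : ℕ} (hn : 3 ≤ n) :
    numCyclesWithAscents n 2 = (reverseCycles n).ncard := by
  unfold numCyclesWithAscents reverseCycles
  congr 1
  ext τ
  refine and_congr_right fun hτ => ?_
  exact ⟨fun h => exists_isReverseLabeling_of_asc_eq_one (by omega),
    fun ⟨c, hc⟩ => by rw [asc_eq_one_of_isReverseLabeling hn hτ hc]⟩

/-! ### Pattern classes and realized cycles -/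

section

variable {n : ℕ}

theorem isCycleOn_univ_of_forall_exists_pow {α : Type*} {τ : Equiv.Perm α} (a : α)
    (h : ∀ b, ∃ k : ℕ, (τ ^ k) a = b) : τ.IsCycleOn Set.univ := by
  have hs : ∀ b, τ.SameCycle a b := fun b => by
    obtain ⟨k, hk⟩ := h b
    exact ⟨k, by simpa using hk⟩
  exact ⟨Set.bijOn_univ.2 τ.bijective, fun x _ y _ => (hs x).symm.trans (hs y)⟩

theorem finRotate_pow_apply (k : ℕ) (i : Fin n) :
    (((finRotate n ^ k) i : Fin n) : ℕ) = ((i : ℕ) + k) % n := by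
  obtain ⟨m, rfl⟩ : ∃ m, n = m + 1 := ⟨n - 1, by have := i.2; omega⟩
  induction k with
  | zero => simp [Nat.mod_eq_of_lt i.2]
  | succ k ih =>
    rw [pow_succ', Equiv.Perm.mul_apply, finRotate_apply, Fin.val_add, ih, Fin.val_one',
      ← Nat.add_mod, add_assoc]

theorem isCycleOn_finRotate (hn : 0 < n) : (finRotate n).IsCycleOn Set.univ :=
  isCycleOn_univ_of_forall_exists_pow ⟨0, hn⟩ fun b =>
    ⟨b, Fin.ext (by rw [finRotate_pow_apply, zero_add, Nat.mod_eq_of_lt b.2])⟩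

/-- The permutation whose cycle notation is the one-line notation of `π`. -/
def toCycle (π : Equiv.Perm (Fin n)) : Equiv.Perm (Fin n) := π * finRotate n * π⁻¹

theorem toCycle_pow_apply (π : Equiv.Perm (Fin n)) (k : ℕ) (i : Fin n) :
    (toCycle π ^ k) (π i) = π ((finRotate n ^ k) i) := by
  simp [toCycle, conj_pow]

theorem isCycleOn_toCycle (hn : 0 < n) (π : Equiv.Perm (Fin n)) :
    (toCycle π).IsCycleOn Set.univ := by
  simpa [toCycle] using (isCycleOn_finRotate hn).conj (g := π)

theorem rotationClass_eq_iff (hn : 0 < n) (π ρ : Equiv.Perm (Fin n)) :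
    rotationClass π = rotationClass ρ ↔ toCycle π = toCycle ρ := by
  constructor
  · intro h
    have hmem : ρ ∈ rotationClass ρ := ⟨0, by simp⟩
    rw [← h] at hmem
    obtain ⟨c, rfl⟩ := hmem
    have hcomm : finRotate n ^ c * finRotate n = finRotate n * finRotate n ^ c :=
      (Commute.pow_self _ c).eq
    rw [toCycle, toCycle, mul_inv_rev, mul_assoc π (_ ^ c), hcomm]
    group
  · -- A permutation commuting with the rotation is the power of it that agrees with it at `0`.
    have key : ∀ {π ρ : Equiv.Perm (Fin n)}, toCycle π = toCycle ρ →
        rotationClass π ⊆ rotationClass ρ := by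
      rintro π ρ h _ ⟨c, rfl⟩
      obtain ⟨k, -, hk⟩ := exists_pow_eq (isCycleOn_finRotate hn) ⟨0, hn⟩ (ρ⁻¹ (π ⟨0, hn⟩))
      refine ⟨k + c, ?_⟩
      rw [pow_add, ← mul_assoc]
      congr 1
      ext1 i
      obtain ⟨m, -, rfl⟩ := exists_pow_eq (isCycleOn_finRotate hn) ⟨0, hn⟩ i
      rw [← toCycle_pow_apply, h, Equiv.Perm.mul_apply, ← Equiv.Perm.mul_apply (_ ^ k), ← pow_add,
        add_comm, pow_add, Equiv.Perm.mul_apply, hk, ← toCycle_pow_apply]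
      simp
    exact fun h => (key h).antisymm (key h.symm)

theorem isNPeriodicPoint_iff {X : Type*} [LinearOrder X] {f : X → X} {x : X} (hn : 0 < n) :
    IsNPeriodicPoint f n x ↔ Function.minimalPeriod f x = n := by
  constructor
  · rintro ⟨_, h1, h2⟩
    have hp : Function.IsPeriodicPt f n x := h1
    refine le_antisymm (hp.minimalPeriod_le hn) (not_lt.1 fun hlt => ?_)
    exact h2 _ (hp.minimalPeriod_pos hn) hlt (Function.isPeriodicPt_minimalPeriod f x)
  · rintro rfl
    exact ⟨hn, Function.isPeriodicPt_minimalPeriod f x, fun i h1 h2 h =>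
      absurd (Function.IsPeriodicPt.minimalPeriod_le (n := i) h1 h) (not_le.2 h2)⟩

/-- The orbit of a periodic point, listed in increasing order, realizes the cycle of its
pattern. -/
theorem isRealization_of_isPat {x : AltWord} {π : Equiv.Perm (Fin n)}
    (hx : (reverseShift 2)^[n] x = x) (hπ : IsPat x (reverseShift 2) n π) :
    IsRealization (toCycle π) fun i => (reverseShift 2)^[(π⁻¹ i : Fin n)] x := by
  refine ⟨fun i j hij => (hπ _ _).1 (by simpa using hij), fun i => ?_⟩
  have h := finRotate_pow_apply 1 (π⁻¹ i)
  rw [pow_one] at h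
  have hp : Function.IsPeriodicPt (reverseShift 2) n x := hx
  have hc : π⁻¹ (toCycle π i) = finRotate n (π⁻¹ i) := by simp [toCycle]
  simp only [hc]
  rw [h, hp.iterate_mod_apply, Function.iterate_succ_apply']

theorem exists_isPat {X : Type*} [LinearOrder X] {f : X → X} {x : X}
    (hx : Function.minimalPeriod f x = n) : ∃ π, IsPat x f n π := by
  have hinj : Function.Injective fun i : Fin n => f^[i] x := fun i j hij =>
    Fin.ext ((Function.iterate_eq_iterate_iff_of_lt_minimalPeriod (by omega) (by omega)).1 hij)
  have hmono : StrictMono ((fun i : Fin n => f^[i] x) ∘ Tuple.sort fun i : Fin n => f^[i] x) :=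
    (Tuple.monotone_sort _).strictMono_of_injective (hinj.comp (Equiv.injective _))
  refine ⟨(Tuple.sort fun i : Fin n => f^[i] x)⁻¹, fun i j => ?_⟩
  rw [← hmono.lt_iff_lt]
  simp

/-- The words of a realization of a cycle of length `n` have least period `n`. -/
theorem IsRealization.minimalPeriod_eq {τ : Equiv.Perm (Fin n)} {g : Fin n → AltWord}
    (hτ : τ.IsCycleOn Set.univ) (hg : IsRealization τ g) (i : Fin n) :
    Function.minimalPeriod (reverseShift 2) (g i) = n := by
  have h : ∀ k, Function.IsPeriodicPt (reverseShift 2) k (g i) ↔ n ∣ k := fun k => by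
    rw [← pow_apply_eq_iff hτ i, Function.IsPeriodicPt, Function.IsFixedPt,
      iterate_reverseShift_of_semiconj hg.2, hg.1.injective.eq_iff]
  refine Nat.dvd_antisymm ?_ ((h _).1 (Function.isPeriodicPt_minimalPeriod _ _))
  exact ((h n).2 dvd_rfl).minimalPeriod_dvd

theorem toCycle_image_periodicPatterns (hn : 0 < n) :
    toCycle '' periodicPatterns (reverseShift 2) n = realizedCycles n := by
  ext τ
  constructor
  · rintro ⟨π, ⟨x, hx, hπ⟩, rfl⟩
    exact ⟨isCycleOn_toCycle hn π, _, isRealization_of_isPat hx.2.1 hπ⟩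
  · rintro ⟨hτ, g, hg⟩
    have hinj : Function.Injective fun k : Fin n => (τ ^ (k : ℕ)) ⟨0, hn⟩ := fun i j hij => by
      refine Fin.ext ?_
      have := (hg.minimalPeriod_eq hτ ⟨0, hn⟩)
      refine (Function.iterate_eq_iterate_iff_of_lt_minimalPeriod (f := reverseShift 2)
        (x := g ⟨0, hn⟩) (by omega) (by omega)).1 ?_
      rw [iterate_reverseShift_of_semiconj hg.2, iterate_reverseShift_of_semiconj hg.2]
      exact congrArg g hij
    let π : Equiv.Perm (Fin n) := Equiv.ofBijective _ (Finite.injective_iff_bijective.1 hinj)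
    have hπ : ∀ k, π k = (τ ^ (k : ℕ)) ⟨0, hn⟩ := fun k => rfl
    refine ⟨π, ⟨g ⟨0, hn⟩, (isNPeriodicPoint_iff hn).2 (hg.minimalPeriod_eq hτ _), fun i j => ?_⟩,
      ?_⟩
    · rw [iterate_reverseShift_of_semiconj hg.2, iterate_reverseShift_of_semiconj hg.2,
        hg.1.lt_iff_lt, hπ, hπ]
    · have hτn : (τ ^ n) ⟨0, hn⟩ = ⟨0, hn⟩ := (pow_apply_eq_iff hτ _ _).2 dvd_rfl
      have hp : Function.IsPeriodicPt τ n ⟨0, hn⟩ := by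
        rwa [Function.IsPeriodicPt, Function.IsFixedPt, Equiv.Perm.iterate_eq_pow]
      ext1 i
      obtain ⟨k, rfl⟩ := π.surjective i
      have h := toCycle_pow_apply π 1 k
      rw [pow_one, pow_one] at h
      have h1 := finRotate_pow_apply 1 k
      rw [pow_one] at h1
      rw [h, hπ, hπ, h1, ← Equiv.Perm.iterate_eq_pow, hp.iterate_mod_apply,
        Function.iterate_succ_apply', Equiv.Perm.iterate_eq_pow]

theorem ncard_image_eq_of_forall_iff {α β γ : Type*} {s : Set α} {f : α → β} {g : α → γ}
    (h : ∀ a b, f a = f b ↔ g a = g b) : (f '' s).ncard = (g '' s).ncard := by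
  refine Set.ncard_congr' (Equiv.ofBijective
    (fun y => ⟨g y.2.choose, Set.mem_image_of_mem g y.2.choose_spec.1⟩) ⟨?_, ?_⟩)
  · intro y z hyz
    have h1 := (h _ _).2 (Subtype.ext_iff.1 hyz)
    rw [y.2.choose_spec.2, z.2.choose_spec.2] at h1
    exact Subtype.ext h1
  · rintro ⟨_, a, ha, rfl⟩
    have hfa : f a ∈ f '' s := Set.mem_image_of_mem f ha
    exact ⟨⟨f a, hfa⟩, Subtype.ext ((h _ _).1 hfa.choose_spec.2)⟩

theorem numPeriodicPatternClasses_reverseShift (hn : 0 < n) :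
    numPeriodicPatternClasses (reverseShift 2) n = (realizedCycles n).ncard := by
  rw [numPeriodicPatternClasses, periodicPatternClasses,
    ncard_image_eq_of_forall_iff (rotationClass_eq_iff hn), toCycle_image_periodicPatterns hn]

/-! ### Counting words of given least period -/

/-- The words with least period `n` under the reverse `2`-shift. -/
def primitiveWords (n : ℕ) : Set AltWord := {x | Function.minimalPeriod (reverseShift 2) x = n}

/-- A word of least period `n` is the same thing as a realized cycle together with a point of it:
the orbit of the word determines the cycle, and the rank of the word in its orbit the point. -/
theorem ncard_primitiveWords (hn : 3 ≤ n) :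
    (primitiveWords n).ncard = (realizedCycles n).ncard * n := by
  have hprod : (realizedCycles n).ncard * n =
      (realizedCycles n ×ˢ (Set.univ : Set (Fin n))).ncard := by
    rw [Set.ncard_prod, Set.ncard_univ, Nat.card_fin]
  rw [hprod]
  symm
  refine Set.ncard_congr (fun p hp => hp.1.2.choose p.2) ?_ ?_ ?_
  · rintro ⟨τ, i⟩ ⟨hτ, -⟩
    exact hτ.2.choose_spec.minimalPeriod_eq hτ.1 i
  · rintro ⟨τ, i⟩ ⟨τ', i'⟩ ⟨hτ, _⟩ ⟨hτ', _⟩ h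
    replace hτ : τ ∈ realizedCycles n := hτ
    replace hτ' : τ' ∈ realizedCycles n := hτ'
    replace h : hτ.2.choose i = hτ'.2.choose i' := h
    have hg := hτ.2.choose_spec
    have hg' := hτ'.2.choose_spec
    -- Both realizations list the orbit of the common word in increasing order.
    have hrange : ∀ {τ : Equiv.Perm (Fin n)} {g : Fin n → AltWord}, τ.IsCycleOn Set.univ →
        IsRealization τ g → ∀ i,
          Set.range g = Set.range fun k : ℕ => (reverseShift 2)^[k] (g i) := by
      intro τ g hτ hg i
      ext y
      simp only [Set.mem_range, iterate_reverseShift_of_semiconj hg.2]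
      constructor
      · rintro ⟨j, rfl⟩
        obtain ⟨k, -, rfl⟩ := exists_pow_eq hτ i j
        exact ⟨k, rfl⟩
      · rintro ⟨k, rfl⟩
        exact ⟨_, rfl⟩
    have hgg : hτ.2.choose = hτ'.2.choose := (hg.1.range_inj hg'.1).1 (by
      rw [hrange hτ.1 hg i, hrange hτ'.1 hg' i', h])
    rw [← hgg] at hg'
    have hi : i = i' := hg.1.injective (by rw [h, hgg])
    have hττ : τ = τ' := by
      ext1 j
      exact hg.1.injective ((hg.2 j).symm.trans (hg'.2 j))
    rw [hi, hττ]
  · intro x hx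
    obtain ⟨π, hπ⟩ := exists_isPat hx
    have hx' : (reverseShift 2)^[n] x = x :=
      ((isNPeriodicPoint_iff (by omega)).2 hx).2.1
    have hg := isRealization_of_isPat hx' hπ
    have hc := isCycleOn_toCycle (show 0 < n by omega) π
    have hmem : toCycle π ∈ realizedCycles n := ⟨hc, _, hg⟩
    refine ⟨(toCycle π, π ⟨0, by omega⟩), ⟨hmem, trivial⟩, ?_⟩
    dsimp only
    rw [hmem.2.choose_spec.unique hn hc hg]
    simp

/-- A word fixed by the `n`-th power of the shift is determined by its first `n` letters, which
are arbitrary. -/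
def periodicWordsEquiv (hn : 0 < n) :
    Function.ptsOfPeriod (reverseShift 2) n ≃ (Fin n → Fin 2) where
  toFun x i := x.1 i
  invFun v := ⟨fun k => v ⟨k % n, Nat.mod_lt _ hn⟩, by
    funext k
    refine (iterate_reverseShift_apply n _ k).trans ?_
    simp⟩
  left_inv x := by
    refine Subtype.ext (funext fun k => ?_)
    have hp : Function.IsPeriodicPt (reverseShift 2) n x.1 := x.2
    have h := congrFun (hp.iterate_mod_apply k) 0
    rwa [iterate_reverseShift_apply, iterate_reverseShift_apply, zero_add, zero_add] at h
  right_inv v := by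
    funext i
    simp [Nat.mod_eq_of_lt i.2]

theorem sum_divisors_ncard_primitiveWords (hn : 0 < n) :
    ∑ d ∈ n.divisors, (primitiveWords d).ncard = 2 ^ n := by
  have hfin : (Function.ptsOfPeriod (reverseShift 2) n).Finite :=
    @Set.toFinite _ _ (Finite.of_equiv _ (periodicWordsEquiv hn).symm)
  have hcard : hfin.toFinset.card = 2 ^ n := by
    rw [← Set.ncard_eq_toFinset_card _ hfin, ← Nat.card_coe_set_eq,
      Nat.card_congr (periodicWordsEquiv hn)]
    simp
  rw [← hcard, Finset.card_eq_sum_card_fiberwise (t := n.divisors)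
    (f := Function.minimalPeriod (reverseShift 2))]
  · refine Finset.sum_congr rfl fun d hd => ?_
    rw [← Set.ncard_coe_finset]
    congr 1
    ext x
    simp only [primitiveWords, Set.mem_ofPred_eq, Finset.coe_filter, Set.Finite.mem_toFinset]
    refine ⟨fun h => ⟨?_, h⟩, And.right⟩
    exact Function.isPeriodicPt_iff_minimalPeriod_dvd.2 (h ▸ Nat.dvd_of_mem_divisors hd)
  · intro x hx
    have hx : Function.IsPeriodicPt (reverseShift 2) n x := by simpa using hx
    simpa [hn.ne'] using hx.minimalPeriod_dvd

theorem necklaceNumber_two_eq (hn : 3 ≤ n) :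
    necklaceNumber 2 n = (realizedCycles n).ncard := by
  have h := ArithmeticFunction.sum_eq_iff_sum_mul_moebius_eq (R := ℚ)
    (f := fun d => ((primitiveWords d).ncard : ℚ)) (g := fun m => (2 : ℚ) ^ m)
  have h := h.1 (fun m hm => by exact_mod_cast sum_divisors_ncard_primitiveWords hm) n (by omega)
  rw [Nat.sum_divisorsAntidiagonal
    (f := fun a b => (ArithmeticFunction.moebius a : ℚ) * (2 : ℚ) ^ b),
    ncard_primitiveWords hn] at h
  have hn0 : (n : ℚ) ≠ 0 := by exact_mod_cast (by omega : n ≠ 0)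
  rw [necklaceNumber, Nat.cast_ofNat, h]
  push_cast
  field_simp

end

/-! ### Cycles that are not realized -/

section

variable {d : ℕ}

/-- The permutation of `d * 2` points obtained by replacing each point `r` by the two consecutive
points `2 r` and `2 r + 1`, and by reversing each of these pairs while moving it as `ρ` does. -/
def double (ρ : Equiv.Perm (Fin d)) : Equiv.Perm (Fin (d * 2)) :=
  (finProdFinEquiv.symm.trans (ρ.prodCongr (Equiv.swap 0 1))).trans finProdFinEquiv

theorem double_apply (ρ : Equiv.Perm (Fin d)) (r : Fin d) (e : Fin 2) :
    double ρ (finProdFinEquiv (r, e)) = finProdFinEquiv (ρ r, Equiv.swap 0 1 e) := by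
  simp [double]

theorem double_pow_apply (ρ : Equiv.Perm (Fin d)) (k : ℕ) (r : Fin d) (e : Fin 2) :
    (double ρ ^ k) (finProdFinEquiv (r, e)) =
      finProdFinEquiv ((ρ ^ k) r, ((Equiv.swap 0 1 : Equiv.Perm (Fin 2)) ^ k) e) := by
  induction k with
  | zero => simp
  | succ k ih =>
    rw [pow_succ', Equiv.Perm.mul_apply, ih, double_apply, pow_succ', pow_succ',
      Equiv.Perm.mul_apply, Equiv.Perm.mul_apply]

theorem double_injective : Function.Injective (double (d := d)) := by
  intro ρ ρ' h
  ext1 r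
  have := congrArg (fun τ => τ (finProdFinEquiv (r, 0))) h
  simp only [double_apply] at this
  exact (Prod.ext_iff.1 (finProdFinEquiv.injective this)).1

theorem finProdFinEquiv_lt_iff (r s : Fin d) (e f : Fin 2) :
    (finProdFinEquiv (r, e) : Fin (d * 2)) < finProdFinEquiv (s, f) ↔
      r < s ∨ (r = s ∧ e < f) := by
  simp only [Fin.lt_def, finProdFinEquiv_apply_val, Fin.ext_iff]
  omega

theorem isCycleOn_double (hd : Odd d) {ρ : Equiv.Perm (Fin d)} (hρ : ρ.IsCycleOn Set.univ) :
    (double ρ).IsCycleOn Set.univ := by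
  have h0 : 0 < d := hd.pos
  refine isCycleOn_univ_of_forall_exists_pow (finProdFinEquiv (⟨0, h0⟩, 0)) fun b => ?_
  obtain ⟨⟨r, e⟩, rfl⟩ := finProdFinEquiv.surjective b
  obtain ⟨k, -, hk⟩ := exists_pow_eq hρ ⟨0, h0⟩ r
  have hs : (Equiv.swap 0 1 : Equiv.Perm (Fin 2)) ^ 2 = 1 := by
    rw [pow_two, Equiv.swap_mul_self]
  by_cases he : ((Equiv.swap 0 1 : Equiv.Perm (Fin 2)) ^ k) 0 = e
  · exact ⟨k, by rw [double_pow_apply, hk, he]⟩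
  · -- Another `d` steps, an odd number, lead back to the same pair with the roles exchanged.
    refine ⟨d + k, ?_⟩
    obtain ⟨m, hm⟩ := hd
    have hsd : (Equiv.swap 0 1 : Equiv.Perm (Fin 2)) ^ d = Equiv.swap 0 1 := by
      rw [hm, pow_succ, pow_mul, hs, one_pow, one_mul]
    rw [double_pow_apply, pow_add, pow_add, Equiv.Perm.mul_apply, Equiv.Perm.mul_apply, hk,
      (pow_apply_eq_iff hρ r d).2 dvd_rfl, hsd]
    generalize ((Equiv.swap 0 1 : Equiv.Perm (Fin 2)) ^ k) 0 = x at he ⊢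
    have hx : ∀ x e : Fin 2, x ≠ e → Equiv.swap 0 1 x = e := by decide
    rw [hx x e he]

theorem IsReverseLabeling.double {ρ : Equiv.Perm (Fin d)} {c : Fin d → Fin 2}
    (hc : IsReverseLabeling ρ c) :
    IsReverseLabeling (double ρ) fun p => c (finProdFinEquiv.symm p).1 := by
  refine ⟨fun p q hpq => ?_, fun p q hpq h => ?_⟩
  all_goals
    obtain ⟨⟨r, e⟩, rfl⟩ := finProdFinEquiv.surjective p
    obtain ⟨⟨s, f⟩, rfl⟩ := finProdFinEquiv.surjective q
  · rw [← not_lt, finProdFinEquiv_lt_iff] at hpq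
    simp only [Equiv.symm_apply_apply]
    exact hc.1 (not_lt.1 fun h => hpq (Or.inl h))
  · simp only [Equiv.symm_apply_apply] at h
    rw [double_apply, double_apply, finProdFinEquiv_lt_iff]
    rcases (finProdFinEquiv_lt_iff _ _ _ _).1 hpq with hlt | ⟨rfl, hlt⟩
    · exact Or.inl (hc.2 _ _ hlt h)
    · have hx : ∀ e f : Fin 2, e < f → Equiv.swap 0 1 f < Equiv.swap 0 1 e := by decide
      exact Or.inr ⟨rfl, hx e f hlt⟩

/-- Both points of a doubled pair have the same itinerary, so no listing is strictly increasing. -/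
theorem double_notMem_realizedCycles (hd3 : 3 ≤ d) {ρ : Equiv.Perm (Fin d)}
    (hρ : ρ ∈ reverseCycles d) : double ρ ∉ realizedCycles (d * 2) := by
  rintro ⟨hτ, g, hg⟩
  obtain ⟨c, hc⟩ := hρ.2
  have hinj := hg.1.injective
  rw [hg.eq_itinerary_of_isReverseLabeling (by omega) hτ hc.double] at hinj
  have h : (finProdFinEquiv (⟨0, by omega⟩, 0) : Fin (d * 2)) =
      finProdFinEquiv (⟨0, by omega⟩, 1) := hinj (by
    funext k
    simp only [itinerary, double_pow_apply, Equiv.symm_apply_apply])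
  simpa using finProdFinEquiv.injective h

end

section

variable {n : ℕ} {τ : Equiv.Perm (Fin n)} {c : Fin n → Fin 2}

theorem eq_one_of_preserves_lt (σ : Equiv.Perm (Fin n))
    (h₁ : ∀ p, p < σ p → σ p < σ (σ p)) (h₂ : ∀ p, σ p < p → σ (σ p) < σ p) : σ = 1 := by
  ext1 p
  by_contra hne
  rcases lt_or_gt_of_ne hne with h | h
  · have hk : ∀ k : ℕ, (σ ^ (k + 1)) p < (σ ^ k) p := fun k => by
      induction k with
      | zero => simpa using h
      | succ k ih =>
        rw [pow_succ' σ (k + 1), pow_succ' σ k, Equiv.Perm.mul_apply, Equiv.Perm.mul_apply]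
        rw [pow_succ' σ k, Equiv.Perm.mul_apply] at ih
        exact h₂ _ ih
    exact not_injective_infinite_finite _ (strictAnti_nat_of_succ_lt (f := fun k => (σ ^ k) p) hk).injective
  · have hk : ∀ k : ℕ, (σ ^ k) p < (σ ^ (k + 1)) p := fun k => by
      induction k with
      | zero => simpa using h
      | succ k ih =>
        rw [pow_succ' σ (k + 1), pow_succ' σ k, Equiv.Perm.mul_apply, Equiv.Perm.mul_apply]
        rw [pow_succ' σ k, Equiv.Perm.mul_apply] at ih
        exact h₁ _ ih
    exact not_injective_infinite_finite _ (strictMono_nat_of_lt_succ (f := fun k => (σ ^ k) p) hk).injective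

theorem itinerary_pow_eq_of_itinerary_eq {p q : Fin n}
    (h : itinerary τ c p = itinerary τ c q) (k : ℕ) :
    itinerary τ c ((τ ^ k) p) = itinerary τ c ((τ ^ k) q) := by
  rw [← iterate_reverseShift_of_semiconj reverseShift_itinerary, h,
    iterate_reverseShift_of_semiconj reverseShift_itinerary]

theorem label_pow_eq_of_itinerary_eq {p q : Fin n}
    (h : itinerary τ c p = itinerary τ c q) (k : ℕ) : c ((τ ^ k) p) = c ((τ ^ k) q) :=
  congrFun h k

/-- If two different points have the same itinerary, they are half a turn of the cycle apart:
an even number of steps preserves the order of points with equal itineraries, so that moving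
along by twice their distance is the identity. -/
theorem IsReverseLabeling.pow_eq_of_itinerary_eq {d : ℕ} {τ : Equiv.Perm (Fin (d * 2))}
    {c : Fin (d * 2) → Fin 2} (hτ : τ.IsCycleOn Set.univ) (hc : IsReverseLabeling τ c)
    {i j : Fin (d * 2)} (hij : i ≠ j) (h : itinerary τ c i = itinerary τ c j) :
    (τ ^ d) i = j := by
  obtain ⟨m, hm, rfl⟩ := exists_pow_eq hτ i j
  have hm0 : m ≠ 0 := by
    rintro rfl
    exact hij (by simp)
  have hfix : ∀ p, itinerary τ c p = itinerary τ c ((τ ^ m) p) := fun p => by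
    obtain ⟨q, -, rfl⟩ := exists_pow_eq hτ i p
    rw [← Equiv.Perm.mul_apply, ← pow_add, add_comm, pow_add, Equiv.Perm.mul_apply]
    exact itinerary_pow_eq_of_itinerary_eq h q
  have hfix2 : ∀ p, itinerary τ c p = itinerary τ c ((τ ^ (m + m)) p) := fun p => by
    rw [pow_add, Equiv.Perm.mul_apply, ← hfix, ← hfix]
  have hone : τ ^ (m + m) = 1 := eq_one_of_preserves_lt _
    (fun p hp => (hc.pow_lt_pow hp _ fun l _ =>
      label_pow_eq_of_itinerary_eq (hfix2 p) l).1 (Even.add_self m))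
    (fun p hp => (hc.pow_lt_pow hp _ fun l _ =>
      label_pow_eq_of_itinerary_eq (hfix2 p).symm l).1 (Even.add_self m))
  have hdvd : d * 2 ∣ m + m := (pow_apply_eq_iff hτ i _).1 (by rw [hone]; rfl)
  obtain ⟨a, ha⟩ := hdvd
  have ha1 : a = 1 := by
    have : a < 2 := by
      by_contra hcon
      have : d * 2 * 2 ≤ d * 2 * a := Nat.mul_le_mul_left _ (by omega)
      omega
    have : a ≠ 0 := by
      rintro rfl
      omega
    omega
  subst ha1
  have hmd : m = d := by omega
  rw [hmd]

/-- A cycle with two decreasing runs whose itineraries are not distinct is a doubled cycle: its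
itineraries coincide in pairs, and the two points of a pair are consecutive because the itinerary
is monotone. -/
theorem exists_eq_double {d : ℕ} {τ : Equiv.Perm (Fin (d * 2))} {c : Fin (d * 2) → Fin 2}
    (hτ : τ.IsCycleOn Set.univ) (hc : IsReverseLabeling τ c)
    (hinj : ¬ Function.Injective (itinerary τ c)) :
    ∃ ρ ∈ reverseCycles d, double ρ = τ := by
  have key := fun {i j} => hc.pow_eq_of_itinerary_eq hτ (i := i) (j := j)
  obtain ⟨i, j, hij, hne⟩ : ∃ i j, itinerary τ c i = itinerary τ c j ∧ i ≠ j := by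
    simpa [Function.Injective] using hinj
  have hd : 0 < d := by have := i.2; omega
  have hs : ∀ p, itinerary τ c ((τ ^ d) p) = itinerary τ c p := fun p => by
    obtain ⟨q, -, rfl⟩ := exists_pow_eq hτ i p
    rw [← Equiv.Perm.mul_apply, ← pow_add, add_comm, pow_add, Equiv.Perm.mul_apply, key hne hij]
    exact (itinerary_pow_eq_of_itinerary_eq hij q).symm
  have hss : ∀ p, (τ ^ d) ((τ ^ d) p) = p := fun p => by
    rw [← Equiv.Perm.mul_apply, ← pow_add]
    exact (pow_apply_eq_iff hτ p _).2 ⟨1, by ring⟩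
  have hsne : ∀ p, (τ ^ d) p ≠ p := fun p h => by
    have := Nat.le_of_dvd hd ((pow_apply_eq_iff hτ p d).1 h)
    omega
  have hmono := hc.monotone_itinerary
  -- The points of a pair are neighbours, the first one being even.
  have hpair : ∀ r : ℕ, ∀ hr : r < d,
      (τ ^ d) (finProdFinEquiv (⟨r, hr⟩, 0)) = finProdFinEquiv (⟨r, hr⟩, 1) := by
    intro r
    induction r using Nat.strong_induction_on with
    | _ r ih =>
    intro hr
    obtain ⟨⟨t, e⟩, ht⟩ := finProdFinEquiv.surjective
      ((τ ^ d) (finProdFinEquiv ((⟨r, hr⟩ : Fin d), (0 : Fin 2))))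
    have hle : (⟨r, hr⟩ : Fin d) ≤ t := by
      by_contra hlt
      have hlt := not_le.1 hlt
      have h1 := ih t hlt t.2
      have h2 := congrArg (τ ^ d) ht
      rw [hss] at h2
      obtain rfl | rfl : e = 0 ∨ e = 1 := by omega
      · have := (Prod.ext_iff.1 (finProdFinEquiv.injective (h1.symm.trans h2))).1
        exact absurd this hlt.ne
      · rw [← h1] at ht
        have := (Prod.ext_iff.1 (finProdFinEquiv.injective ((τ ^ d).injective ht))).1
        exact absurd this hlt.ne
    have hle' : (finProdFinEquiv ((⟨r, hr⟩ : Fin d), (1 : Fin 2)) : Fin (d * 2)) ≤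
        finProdFinEquiv (t, e) := by
      rw [← not_lt, finProdFinEquiv_lt_iff]
      rintro (h | ⟨rfl, he⟩)
      · exact absurd h (not_lt.2 hle)
      · have he : e = 0 := by omega
        exact hsne _ (by rw [← ht, he])
    have hlt : (finProdFinEquiv ((⟨r, hr⟩ : Fin d), (0 : Fin 2)) : Fin (d * 2)) <
        finProdFinEquiv ((⟨r, hr⟩ : Fin d), (1 : Fin 2)) :=
      (finProdFinEquiv_lt_iff _ _ _ _).2 (Or.inr ⟨rfl, by decide⟩)
    refine key hlt.ne (le_antisymm (hmono hlt.le) ?_)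
    rw [← hs (finProdFinEquiv ((⟨r, hr⟩ : Fin d), (0 : Fin 2))), ← ht]
    exact hmono hle'
  have hcomm : ∀ p, τ ((τ ^ d) p) = (τ ^ d) (τ p) := fun p => by
    rw [← Equiv.Perm.mul_apply, ← Equiv.Perm.mul_apply, (Commute.self_pow τ d).eq]
  have hex : ∀ r : Fin d, ∃ s : Fin d, τ (finProdFinEquiv (r, 0)) = finProdFinEquiv (s, 1) ∧
      τ (finProdFinEquiv (r, 1)) = finProdFinEquiv (s, 0) := by
    intro r
    obtain ⟨⟨s, e⟩, hse⟩ := finProdFinEquiv.surjective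
      (τ (finProdFinEquiv (r, (0 : Fin 2))))
    have hr := hpair r r.2
    have hlt : (finProdFinEquiv (r, (0 : Fin 2)) : Fin (d * 2)) <
        finProdFinEquiv (r, (1 : Fin 2)) :=
      (finProdFinEquiv_lt_iff _ _ _ _).2 (Or.inr ⟨rfl, by decide⟩)
    have h1 : τ (finProdFinEquiv (r, 1)) = (τ ^ d) (finProdFinEquiv (s, e)) := by
      rw [hse, ← hcomm, hr]
    have hlabel : c (finProdFinEquiv (r, 0)) = c (finProdFinEquiv (r, 1)) := by
      have := congrFun (hs (finProdFinEquiv (r, 0))) 0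
      rw [hr] at this
      exact this.symm
    have hdesc := hc.2 _ _ hlt hlabel
    rw [h1, ← hse] at hdesc
    refine ⟨s, ?_⟩
    obtain rfl | rfl : e = 0 ∨ e = 1 := by omega
    · rw [hpair s s.2, finProdFinEquiv_lt_iff] at hdesc
      simp at hdesc
    · exact ⟨hse.symm, by rw [h1, ← hpair s s.2, hss]⟩
  choose ρ₀ h₀ h₁ using hex
  have hρ₀ : Function.Injective ρ₀ := fun r s hrs => by
    have : τ (finProdFinEquiv (r, 0)) = τ (finProdFinEquiv (s, 0)) := by rw [h₀, h₀, hrs]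
    exact (Prod.ext_iff.1 (finProdFinEquiv.injective (τ.injective this))).1
  let ρ : Equiv.Perm (Fin d) := Equiv.ofBijective ρ₀ (Finite.injective_iff_bijective.1 hρ₀)
  have hdouble : double ρ = τ := by
    ext1 p
    obtain ⟨⟨r, e⟩, rfl⟩ := finProdFinEquiv.surjective p
    rw [double_apply]
    obtain rfl | rfl : e = 0 ∨ e = 1 := by omega
    · rw [h₀, Equiv.swap_apply_left]
      rfl
    · rw [h₁, Equiv.swap_apply_right]
      rfl
  refine ⟨ρ, ⟨isCycleOn_univ_of_forall_exists_pow ⟨0, hd⟩ fun s => ?_,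
    fun r => c (finProdFinEquiv (r, 0)), fun r s hrs => hc.1 ?_, fun r s hrs h => ?_⟩, hdouble⟩
  · obtain ⟨k, -, hk⟩ := exists_pow_eq hτ (finProdFinEquiv (⟨0, hd⟩, 0)) (finProdFinEquiv (s, 0))
    rw [← hdouble, double_pow_apply] at hk
    exact ⟨k, (Prod.ext_iff.1 (finProdFinEquiv.injective hk)).1⟩
  · rw [← not_lt, finProdFinEquiv_lt_iff]
    rintro (h | ⟨-, h⟩)
    · exact absurd h (not_lt.2 hrs)
    · exact absurd h (lt_irrefl _)
  · have hlt := hc.2 _ _ ((finProdFinEquiv_lt_iff r s 0 0).2 (Or.inl hrs)) h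
    rw [h₀, h₀, finProdFinEquiv_lt_iff] at hlt
    rcases hlt with hlt | ⟨-, hlt⟩
    · exact hlt
    · exact absurd hlt (lt_irrefl _)

theorem reverseCycles_eq_union {d : ℕ} (hd : Odd d) :
    reverseCycles (d * 2) = realizedCycles (d * 2) ∪ double '' reverseCycles d := by
  ext τ
  constructor
  · rintro ⟨hτ, c, hc⟩
    by_cases hinj : Function.Injective (itinerary τ c)
    · exact Or.inl ⟨hτ, _, hc.monotone_itinerary.strictMono_of_injective hinj,
        reverseShift_itinerary⟩
    · exact Or.inr (exists_eq_double hτ hc hinj)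
  · rintro (⟨hτ, g, hg⟩ | ⟨ρ, ⟨hρ, c, hc⟩, rfl⟩)
    · exact ⟨hτ, _, hg.isReverseLabeling⟩
    · exact ⟨isCycleOn_double hd hρ, _, hc.double⟩

theorem ncard_reverseCycles_mul_two {d : ℕ} (hd : Odd d) (hd3 : 3 ≤ d) :
    (reverseCycles (d * 2)).ncard = (realizedCycles (d * 2)).ncard + (reverseCycles d).ncard := by
  rw [reverseCycles_eq_union hd, Set.ncard_union_eq,
    Set.ncard_image_of_injective _ double_injective]
  rw [Set.disjoint_right]
  rintro _ ⟨ρ, hρ, rfl⟩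
  exact double_notMem_realizedCycles hd3 hρ

end

end SignedShift

theorem theorem3p13 (n : ℕ) (hn : 3 ≤ n) (hmod : n % 4 = 2) :
    (SignedShift.numPeriodicPatternClasses (SignedShift.reverseShift 2) n : ℚ) =
        (SignedShift.numCyclesWithAscents n 2 : ℚ) - SignedShift.numCyclesWithAscents (n / 2) 2 ∧
      (SignedShift.numCyclesWithAscents n 2 : ℚ) - SignedShift.numCyclesWithAscents (n / 2) 2 =
        SignedShift.necklaceNumber 2 n := by
  obtain ⟨d, rfl⟩ : ∃ d, n = d * 2 := ⟨n / 2, by omega⟩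
  have hd : Odd d := Nat.odd_iff.2 (by omega)
  have hd3 : 3 ≤ d := by omega
  rw [Nat.mul_div_cancel _ two_pos, SignedShift.numCyclesWithAscents_two hn,
    SignedShift.numCyclesWithAscents_two hd3, SignedShift.ncard_reverseCycles_mul_two hd hd3,
    SignedShift.numPeriodicPatternClasses_reverseShift (by omega),
    SignedShift.necklaceNumber_two_eq hn]
  push_cast
  constructor <;> ring
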